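/- Let $F$ be the free group on two generators, $M = F/F''$, and let $\widehat{M}$ be the profinite completion of $M$ (the free profinite metabelian group of rank 2). A continuous endomorphism (resp. topological automorphism) $\gamma$ of $\widehat{M}$ is called an IA-endomorphism (resp. IA-automorphism) if it induces the identity on the abelianization $\widehat{M}^{\mathrm{ab}}$, the quotient of $\widehat{M}$ by the closure of its commutator subgroup. (a) Let $G$ be a finite metabelian group which can be generated by two elements, and let $\varphi : \widehat{M} \to G$ be a continuous surjective homomorphism, where $G$ is discrete. Then every IA-endomorphism $\gamma$ of $\widehat{M}$ satisfies $\gamma(\ker\varphi) \subseteq \ker\varphi$; hence $\gamma$ descends to $G$, i.e. there is an endomorphism $\delta$ of $G$ with $\delta\circ\varphi = \varphi\circ\gamma$. (b) If $\gamma$ is an IA-automorphism of $\widehat{M}$, then $\gamma(N) = N$ for every open normal subgroup $N$ of $\widehat{M}$. -/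

import Mathlib

/-- The free metabelian group of rank 2: `M = F / F''`, with `F` free on two generators. -/
abbrev FreeMetabelianTwo : Type :=
  FreeGroup (Fin 2) ⧸ derivedSeries (FreeGroup (Fin 2)) 2

/-- `M̂`, the free profinite metabelian group of rank 2: the profinite completion of `F / F''`. -/
noncomputable abbrev MHat : ProfiniteGrp.{0} :=
  ProfiniteGrp.ProfiniteCompletion.completion (GrpCat.of FreeMetabelianTwo)

/-- A continuous endomorphism of a topological group is an IA-endomorphism if it acts as the
identity on the (topological) abelianization, i.e. on the quotient of the group by the closure of
its commutator subgroup. -/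
def IsIAEnd {M : Type*} [Group M] [TopologicalSpace M] [IsTopologicalGroup M]
    (γ : M →ₜ* M) : Prop :=
  ∀ x : M, (QuotientGroup.mk (γ x) : TopologicalAbelianization M) = QuotientGroup.mk x

/-- IA-automorphisms: topological automorphisms acting as the identity on the abelianization. -/
def IsIAut {M : Type*} [Group M] [TopologicalSpace M] [IsTopologicalGroup M]
    (γ : M ≃ₜ* M) : Prop :=
  IsIAEnd (γ : M →ₜ* M)

/-- A group is metabelian if its commutator subgroup is abelian. -/
def IsMetabelian (G : Type*) [Group G] : Prop :=
  ∀ x ∈ commutator G, ∀ y ∈ commutator G, x * y = y * x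

/-- A group is 2-generated if it is generated by two (not necessarily distinct) elements. -/
def IsTwoGenerated (G : Type*) [Group G] : Prop :=
  ∃ a b : G, Subgroup.closure {a, b} = ⊤

/-!
Everything reduces to a statement about abstract groups: if `F` is generated by two elements
`x, y`, `ψ : F →* G` is onto a metabelian group and `χ : F →* G` agrees with `ψ` modulo the
commutator subgroup `G'`, then `ker ψ ≤ ker χ` (`ker_le_ker_of_div_mem_commutator`).

The map `w ↦ χ w * (ψ w)⁻¹` is a 1-cocycle of `F` with values in the abelian group `G'`, on which
`F` acts by conjugation through `ψ`. The cocycles that vanish on `ker ψ` form a group, stable under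
conjugation by `G` because the abelianization of `G` acts on `G'`. Hence the values at `x` of those
that vanish at `y` form a normal subgroup `H` of `G` (`cocycleValues`). Every `g : G` gives the
principal cocycle `w ↦ ⁅g, ψ w⁆`, which vanishes on `ker ψ`; taking `g = ψ y` shows that
`⁅ψ y, ψ x⁆ ∈ H`, and a normal subgroup containing the commutator of two generators contains `G'`.
So the value at `x`, and likewise the value at `y`, of a cocycle vanishing on `ker ψ` can be
prescribed freely in `G'`. As a cocycle is determined by its values at `x` and `y`, all cocycles
vanish on `ker ψ`, in particular that of `χ`.

A continuous homomorphism from `M̂` onto a discrete group restricts to a surjection from the dense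
image of the free group, and its kernel is open, so the abstract statement applies to `φ` and
`φ ∘ γ`. The second part of the theorem follows by applying this to `γ` and to `γ⁻¹`, with `φ` the
quotient map by an open normal subgroup.
-/

/-! ### Cocycles with values in the commutator subgroup -/

/-- `D` is a 1-cocycle of `F` with values in the commutator subgroup of `G`, on which `F` acts by
conjugation through `ψ`, and `D` vanishes on the kernel of `ψ`. -/
structure IsKerTrivialCocycle {F G : Type*} [Group F] [Group G] (ψ : F →* G) (D : F → G) :
    Prop where
  mem_commutator : ∀ w, D w ∈ commutator G
  map_mul : ∀ w w', D (w * w') = D w * (ψ w * D w' * (ψ w)⁻¹)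
  eq_one_of_map_eq_one : ∀ w, ψ w = 1 → D w = 1

section Cocycle

open scoped commutatorElement

variable {F G : Type*} [Group F] [Group G] {ψ : F →* G} {D E : F → G}

/-- The action of `G` on its abelian commutator subgroup factors through the abelianization. -/
theorem IsMetabelian.conj_conj_comm (hG : IsMetabelian G) (g h : G) {d : G}
    (hd : d ∈ commutator G) : g * (h * d * h⁻¹) * g⁻¹ = h * (g * d * g⁻¹) * h⁻¹ := by
  have hgh : h⁻¹ * g⁻¹ * h * g ∈ commutator G := by
    simpa [commutatorElement_def, commutator_def] using
      Subgroup.commutator_mem_commutator (Subgroup.mem_top h⁻¹) (Subgroup.mem_top g⁻¹)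
  have key := hG _ hgh _ hd
  have : h * (g * d * g⁻¹) * h⁻¹ = g * h * ((h⁻¹ * g⁻¹ * h * g) * d) * (g⁻¹ * h⁻¹) := by group
  rw [this, key]
  group

theorem IsMetabelian.mul_mul_mul_comm (hG : IsMetabelian G) (a d : G) {b c : G}
    (hb : b ∈ commutator G) (hc : c ∈ commutator G) : a * b * (c * d) = a * c * (b * d) := by
  rw [mul_assoc, ← mul_assoc b, hG b hb c hc]
  group

namespace IsKerTrivialCocycle

protected theorem one (ψ : F →* G) : IsKerTrivialCocycle ψ fun _ => 1 :=
  ⟨fun _ => one_mem _, by simp, fun _ _ => rfl⟩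

protected theorem mul (hG : IsMetabelian G) (hD : IsKerTrivialCocycle ψ D)
    (hE : IsKerTrivialCocycle ψ E) : IsKerTrivialCocycle ψ fun w => D w * E w where
  mem_commutator w := mul_mem (hD.mem_commutator w) (hE.mem_commutator w)
  map_mul w w' := by
    have h₁ := (inferInstance : (commutator G).Normal).conj_mem _ (hD.mem_commutator w') (ψ w)
    rw [hD.map_mul, hE.map_mul, hG.mul_mul_mul_comm _ _ h₁ (hE.mem_commutator w)]
    group
  eq_one_of_map_eq_one w hw := by
    simp [hD.eq_one_of_map_eq_one w hw, hE.eq_one_of_map_eq_one w hw]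

protected theorem inv (hG : IsMetabelian G) (hD : IsKerTrivialCocycle ψ D) :
    IsKerTrivialCocycle ψ fun w => (D w)⁻¹ where
  mem_commutator w := inv_mem (hD.mem_commutator w)
  map_mul w w' := by
    have h₁ := (inferInstance : (commutator G).Normal).conj_mem _ (hD.mem_commutator w') (ψ w)
    rw [hD.map_mul, hG _ (hD.mem_commutator w) _ h₁]
    group
  eq_one_of_map_eq_one w hw := by simp [hD.eq_one_of_map_eq_one w hw]

protected theorem conj (hG : IsMetabelian G) (hD : IsKerTrivialCocycle ψ D) (g : G) :
    IsKerTrivialCocycle ψ fun w => g * D w * g⁻¹ where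
  mem_commutator w := (inferInstance : (commutator G).Normal).conj_mem _ (hD.mem_commutator w) g
  map_mul w w' := by
    rw [← hG.conj_conj_comm g (ψ w) (hD.mem_commutator w'), hD.map_mul]
    group
  eq_one_of_map_eq_one w hw := by simp [hD.eq_one_of_map_eq_one w hw]

/-- The principal cocycles. -/
theorem principal (ψ : F →* G) (g : G) : IsKerTrivialCocycle ψ fun w => ⁅g, ψ w⁆ where
  mem_commutator w :=
    Subgroup.commutator_mem_commutator (Subgroup.mem_top g) (Subgroup.mem_top (ψ w))
  map_mul w w' := by
    simp only [commutatorElement_def, _root_.map_mul]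
    group
  eq_one_of_map_eq_one w hw := by simp [hw]

/-- The homomorphism `w ↦ D w * ψ w` attached to a cocycle `D`. -/
def toMonoidHom (hD : IsKerTrivialCocycle ψ D) : F →* G :=
  MonoidHom.mk' (fun w => D w * ψ w) fun w w' => by
    rw [hD.map_mul, _root_.map_mul]
    group

end IsKerTrivialCocycle

/-- The values at `x` of the cocycles that vanish at `y` and on the kernel of `ψ`. -/
def cocycleValues (hG : IsMetabelian G) (ψ : F →* G) (x y : F) : Subgroup G where
  carrier := {u | ∃ D, IsKerTrivialCocycle ψ D ∧ D x = u ∧ D y = 1}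
  one_mem' := ⟨_, .one ψ, rfl, rfl⟩
  mul_mem' := by
    rintro _ _ ⟨D, hD, rfl, hy⟩ ⟨E, hE, rfl, hy'⟩
    exact ⟨_, hD.mul hG hE, rfl, by simp [hy, hy']⟩
  inv_mem' := by
    rintro _ ⟨D, hD, rfl, hy⟩
    exact ⟨_, hD.inv hG, rfl, by simp [hy]⟩

theorem mem_cocycleValues {hG : IsMetabelian G} {x y : F} {u : G} :
    u ∈ cocycleValues hG ψ x y ↔ ∃ D, IsKerTrivialCocycle ψ D ∧ D x = u ∧ D y = 1 :=
  Iff.rfl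

theorem normal_cocycleValues (hG : IsMetabelian G) (ψ : F →* G) (x y : F) :
    (cocycleValues hG ψ x y).Normal where
  conj_mem := by
    rintro _ ⟨D, hD, rfl, hy⟩ g
    exact ⟨_, hD.conj hG g, rfl, by simp [hy]⟩

theorem commutator_le_of_closure_pair_eq_top {a b : G}
    (hab : Subgroup.closure {a, b} = ⊤) (H : Subgroup G) [H.Normal] (h : ⁅a, b⁆ ∈ H) :
    commutator G ≤ H := by
  have hQ : Subgroup.closure {(a : G ⧸ H), (b : G ⧸ H)} = ⊤ := by
    have := congrArg (Subgroup.map (QuotientGroup.mk' H)) hab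
    rwa [MonoidHom.map_closure, Set.image_pair, ← MonoidHom.range_eq_map,
      QuotientGroup.range_mk'] at this
  have hc : Commute (a : G ⧸ H) (b : G ⧸ H) := by
    rw [← commutatorElement_eq_one_iff_commute]
    exact (QuotientGroup.eq_one_iff ⁅a, b⁆).2 h
  have h₁ : ∀ s ∈ ({(a : G ⧸ H), (b : G ⧸ H)} : Set (G ⧸ H)),
      ∀ t ∈ ({(a : G ⧸ H), (b : G ⧸ H)} : Set (G ⧸ H)), s * t = t * s := by
    rintro s (rfl | rfl) t (rfl | rfl)
    exacts [rfl, hc, hc.symm, rfl]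
  refine (Subgroup.commutator_le).2 fun g _ k _ => ?_
  rw [← QuotientGroup.eq_one_iff]
  have hcomm := (Subgroup.isMulCommutative_closure h₁).is_comm.comm
    ⟨(g : G ⧸ H), hQ ▸ Subgroup.mem_top _⟩ ⟨(k : G ⧸ H), hQ ▸ Subgroup.mem_top _⟩
  exact commutatorElement_eq_one_iff_mul_comm.2 (congrArg Subtype.val hcomm)

theorem commutator_le_cocycleValues (hG : IsMetabelian G) (hψ : Function.Surjective ψ) {x y : F}
    (hxy : Subgroup.closure {x, y} = ⊤) : commutator G ≤ cocycleValues hG ψ x y := by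
  have := normal_cocycleValues hG ψ x y
  refine commutator_le_of_closure_pair_eq_top (a := ψ y) (b := ψ x) ?_ _ ?_
  · rw [Set.pair_comm, ← Set.image_pair, ← MonoidHom.map_closure, hxy, ← MonoidHom.range_eq_map,
      MonoidHom.range_eq_top.2 hψ]
  · exact ⟨_, .principal ψ (ψ y), rfl, commutatorElement_self _⟩

/-- Both values of the cocycle `w ↦ χ w / ψ w` at the generators are realised by cocycles that
vanish on the kernel of `ψ`, so this cocycle is the product of those and vanishes there too. -/
theorem ker_le_ker_of_div_mem_commutator (hG : IsMetabelian G) (hψ : Function.Surjective ψ)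
    {x y : F} (hxy : Subgroup.closure {x, y} = ⊤) {χ : F →* G}
    (hχ : ∀ w, χ w / ψ w ∈ commutator G) : ψ.ker ≤ χ.ker := by
  obtain ⟨D, hD, hDx, hDy⟩ :=
    mem_cocycleValues.1 (commutator_le_cocycleValues hG hψ hxy (hχ x))
  obtain ⟨E, hE, hEy, hEx⟩ :=
    mem_cocycleValues.1 (commutator_le_cocycleValues hG hψ (Set.pair_comm x y ▸ hxy) (hχ y))
  have hDE := hD.mul hG hE
  have heq : χ = hDE.toMonoidHom := by
    refine MonoidHom.eq_of_eqOn_dense hxy ?_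
    rintro w (rfl | rfl)
    · simp [IsKerTrivialCocycle.toMonoidHom, hDx, hEx]
    · simp [IsKerTrivialCocycle.toMonoidHom, hDy, hEy]
  intro w hw
  rw [MonoidHom.mem_ker] at hw ⊢
  rw [heq]
  simpa [IsKerTrivialCocycle.toMonoidHom, hw] using hDE.eq_one_of_map_eq_one w hw

end Cocycle

/-! ### The profinite completion -/

/-- The canonical homomorphism from the free group of rank 2 to `M̂`. -/
noncomputable def freeGroupToMHat : FreeGroup (Fin 2) →* MHat :=
  (ProfiniteGrp.ProfiniteCompletion.eta (GrpCat.of FreeMetabelianTwo)).hom.comp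
    (QuotientGroup.mk' (derivedSeries (FreeGroup (Fin 2)) 2))

theorem denseRange_freeGroupToMHat : DenseRange freeGroupToMHat := by
  have h := ProfiniteGrp.ProfiniteCompletion.denseRange (GrpCat.of FreeMetabelianTwo)
  have hs : Function.Surjective
      (QuotientGroup.mk' (derivedSeries (FreeGroup (Fin 2)) 2)) :=
    QuotientGroup.mk'_surjective _
  intro z
  have hz := h z
  rwa [← hs.range_comp] at hz

theorem closure_freeGroup_fin_two :
    Subgroup.closure {FreeGroup.of (0 : Fin 2), FreeGroup.of 1} = ⊤ := by
  rw [← FreeGroup.closure_range_of]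
  congr 1
  ext z
  simp [Fin.exists_fin_two, eq_comm]

section Discrete

variable {G : Type*} [Group G] [TopologicalSpace G] [DiscreteTopology G] {φ : MHat →ₜ* G}

theorem surjective_comp_freeGroupToMHat (hφ : Function.Surjective φ) :
    Function.Surjective (φ.toMonoidHom.comp freeGroupToMHat) := by
  intro g
  have h := (hφ.denseRange.comp denseRange_freeGroupToMHat φ.continuous_toFun).closure_eq
  rw [closure_discrete] at h
  exact h.ge (Set.mem_univ g)

/-- The second derived subgroup of the free group dies in `M̂`, hence in its discrete quotients. -/
theorem isMetabelian_of_surjective (hφ : Function.Surjective φ) : IsMetabelian G := by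
  set f := φ.toMonoidHom.comp freeGroupToMHat
  have hf : Function.Surjective f := surjective_comp_freeGroupToMHat hφ
  have h2 : derivedSeries G 2 = ⊥ := by
    rw [← map_derivedSeries_eq hf, Subgroup.map_eq_bot_iff]
    intro w hw
    have : QuotientGroup.mk' (derivedSeries (FreeGroup (Fin 2)) 2) w = 1 :=
      (QuotientGroup.eq_one_iff w).2 hw
    change φ ((ProfiniteGrp.ProfiniteCompletion.eta (GrpCat.of FreeMetabelianTwo)).hom
      (QuotientGroup.mk' (derivedSeries (FreeGroup (Fin 2)) 2) w)) = 1
    rw [this, map_one, map_one]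
  rw [derivedSeries_succ, derivedSeries_one] at h2
  intro a ha b hb
  rw [← commutatorElement_eq_one_iff_mul_comm, ← Subgroup.mem_bot, ← h2]
  exact Subgroup.commutator_mem_commutator ha hb

theorem IsIAEnd.map_div_mem_commutator {γ : MHat →ₜ* MHat} (hγ : IsIAEnd γ) (φ : MHat →ₜ* G)
    (z : MHat) : φ (γ z) / φ z ∈ commutator G := by
  have hz : z⁻¹ * γ z ∈ (commutator MHat).topologicalClosure :=
    QuotientGroup.eq.1 (hγ z).symm
  have hle : (commutator MHat).topologicalClosure ≤ (commutator G).comap φ.toMonoidHom := by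
    refine Subgroup.topologicalClosure_minimal _ ?_ ?_
    · rw [← Subgroup.map_le_iff_le_comap]
      exact map_derivedSeries_le_derivedSeries φ.toMonoidHom 1
    · exact (isClosed_discrete (commutator G : Set G)).preimage φ.continuous_toFun
  have h := (inferInstance : (commutator G).Normal).conj_mem _ (hle hz) (φ z)
  simpa [div_eq_mul_inv] using h

theorem IsIAEnd.ker_le_ker_comp {γ : MHat →ₜ* MHat} (hγ : IsIAEnd γ)
    (hφ : Function.Surjective φ) {z : MHat} (hz : φ z = 1) : φ (γ z) = 1 := by
  have habs : ∀ w, φ (freeGroupToMHat w) = 1 → φ (γ (freeGroupToMHat w)) = 1 := fun w hw =>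
    ker_le_ker_of_div_mem_commutator (isMetabelian_of_surjective hφ)
      (surjective_comp_freeGroupToMHat hφ) closure_freeGroup_fin_two
      (χ := (φ.comp γ).toMonoidHom.comp freeGroupToMHat)
      (fun w => hγ.map_div_mem_commutator φ (freeGroupToMHat w)) hw
  -- Near `z`, both `φ` and `φ ∘ γ` are constant, so `z` may be moved into the dense subgroup.
  have hopen : IsOpen {t : MHat | φ t = φ z ∧ φ (γ t) = φ (γ z)} :=
    ((isOpen_discrete {φ z}).preimage φ.continuous_toFun).inter
      ((isOpen_discrete {φ (γ z)}).preimage (φ.comp γ).continuous_toFun)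
  obtain ⟨w, hw, hw'⟩ := denseRange_freeGroupToMHat.exists_mem_open hopen ⟨z, rfl, rfl⟩
  rw [← hw']
  exact habs w (hw.trans hz)

end Discrete

theorem IsIAEnd.map_le {γ : MHat →ₜ* MHat} (hγ : IsIAEnd γ) {N : Subgroup MHat} (hN : N.Normal)
    (hopen : IsOpen (N : Set MHat)) {z : MHat} (hz : z ∈ N) : γ z ∈ N := by
  have : DiscreteTopology (MHat ⧸ N) := QuotientGroup.discreteTopology hopen
  let φ : MHat →ₜ* MHat ⧸ N := ⟨QuotientGroup.mk' N, QuotientGroup.continuous_mk⟩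
  have h := hγ.ker_le_ker_comp (φ := φ) (QuotientGroup.mk'_surjective N) (z := z)
    ((QuotientGroup.eq_one_iff z).2 hz)
  exact (QuotientGroup.eq_one_iff (γ z)).1 h

theorem IsIAut.symm {M : Type*} [Group M] [TopologicalSpace M] [IsTopologicalGroup M]
    {γ : M ≃ₜ* M} (hγ : IsIAut γ) : IsIAut γ.symm := fun z => by
  have h := hγ (γ.symm z)
  simp only [ContinuousMonoidHom.coe_coe, ContinuousMulEquiv.apply_symm_apply] at h
  exact h.symm

theorem mainTheorem6 :
    (∀ (G : Type*) [Group G] [Finite G] [TopologicalSpace G] [DiscreteTopology G],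
      IsMetabelian G → IsTwoGenerated G →
      ∀ φ : MHat →ₜ* G, Function.Surjective φ →
      ∀ γ : MHat →ₜ* MHat, IsIAEnd γ →
        φ.toMonoidHom.ker.map γ.toMonoidHom ≤ φ.toMonoidHom.ker ∧
        ∃ δ : G →* G, ∀ x : MHat, δ (φ x) = φ (γ x)) ∧
    (∀ γ : MHat ≃ₜ* MHat, IsIAut γ →
      ∀ N : Subgroup MHat, N.Normal → IsOpen (N : Set MHat) →
        N.map γ.toMulEquiv.toMonoidHom = N) := by
  refine ⟨fun G _ _ _ _ _ _ φ hφ γ hγ => ?_, fun γ hγ N hN hopen => ?_⟩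
  · have hker : φ.toMonoidHom.ker ≤ (φ.comp γ).toMonoidHom.ker := fun z hz =>
      hγ.ker_le_ker_comp hφ hz
    refine ⟨Subgroup.map_le_iff_le_comap.2 hker,
      φ.toMonoidHom.liftOfSurjective hφ ⟨(φ.comp γ).toMonoidHom, hker⟩, fun z => ?_⟩
    exact MonoidHom.liftOfRightInverse_comp_apply _ _ _ ⟨(φ.comp γ).toMonoidHom, hker⟩ z
  · refine le_antisymm ?_ fun z hz => ?_
    · rintro _ ⟨z, hz, rfl⟩
      exact IsIAEnd.map_le hγ hN hopen hz
    · exact ⟨γ.symm z, IsIAEnd.map_le hγ.symm hN hopen hz, γ.apply_symm_apply z⟩
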